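/- Let $n\ge 2$ and let $\Lambda$ be an Artinian algebra, that is, an algebra that is finitely generated as a module over a commutative Artinian ring $R$. Modules are left modules, and $\operatorname{mod}\Lambda$ is the category of finitely generated $\Lambda$-modules. For a module $M$ let $0\to M\to I^0(M)\to I^1(M)\to\cdots$ be a minimal injective resolution; in particular $I^0(M)$ is the injective envelope of $M$. Suppose that $\operatorname{gl.dim}\Lambda=n$ and that $\Lambda$ is an $(n-1)$-Auslander algebra, i.e. $\operatorname{gl.dim}\Lambda\le n$ and $I^0(\Lambda),\dots,I^{n-1}(\Lambda)$ are projective. Let $\mathscr C$ be a maximal $(n-1)$-orthogonal subcategory of $\operatorname{mod}\Lambda$, i.e. a functorially finite full subcategory of $\operatorname{mod}\Lambda$ such that $$\mathscr C=\{X\in\operatorname{mod}\Lambda : \operatorname{Ext}^i_\Lambda(X,C)=0 \text{ for all } C\in\mathscr C,\ 1\le i\le n-1\}=\{X\in\operatorname{mod}\Lambda : \operatorname{Ext}^i_\Lambda(C,X)=0 \text{ for all } C\in\mathscr C,\ 1\le i\le n-1\}.$$ Let $S$ be a simple $\Lambda$-module with $\operatorname{pd}_\Lambda S=n$. Then: (1)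 $S$ is injective if and only if $S\in\mathscr C$ and $\operatorname{Hom}_\Lambda(S,C)=0$ for every indecomposable module $C\in\mathscr C$ with $C\not\cong I^0(S)$. (2) $1\le\operatorname{id}_\Lambda S\le n-1$ if and only if $S\notin\mathscr C$ and $\operatorname{Hom}_\Lambda(S,C)=0$ for every indecomposable module $C\in\mathscr C$ with $C\not\cong I^0(S)$. (3) $\operatorname{id}_\Lambda S=n$ if and only if $\operatorname{Hom}_\Lambda(S,C)\ne 0$ for some indecomposable module $C\in\mathscr C$ with $C\not\cong I^0(S)$. Moreover, each of (1), (2), (3) also holds with "indecomposable" replaced by "non-projective indecomposable". -/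

import Mathlib

open CategoryTheory

universe u

namespace HigherAuslander

/-- A submodule `U` of `M` is essential if it meets every nonzero submodule of `M` nontrivially. -/
def IsEssentialSubmodule {Λ : Type u} [Ring Λ] {M : Type u} [AddCommGroup M] [Module Λ M]
    (U : Submodule Λ M) : Prop :=
  ∀ N : Submodule Λ M, N ≠ ⊥ → N ⊓ U ≠ ⊥

/-- `f : M ⟶ E` is an injective envelope of `M`: a monomorphism onto an essential submodule of an
injective module. -/
structure IsInjectiveEnvelope {Λ : Type u} [Ring Λ] {M E : ModuleCat.{u} Λ} (f : M ⟶ E) :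
    Prop where
  mono : Mono f
  injective : Injective E
  essential : IsEssentialSubmodule (LinearMap.range f.hom)

/-- `E` is (isomorphic to) the injective envelope `I⁰(M)` of `M`. Injective envelopes are unique up
to isomorphism, so `E ≅ I⁰(M)` holds exactly when `E` is the target of an injective envelope of
`M`. -/
def IsInjectiveEnvelopeOf {Λ : Type u} [Ring Λ] (M E : ModuleCat.{u} Λ) : Prop :=
  ∃ f : M ⟶ E, IsInjectiveEnvelope f

/-- An injective resolution `0 ⟶ M ⟶ I⁰ ⟶ I¹ ⟶ ⋯` is minimal if for every `i` the module
`ker (Iⁱ ⟶ Iⁱ⁺¹)` (that is, the image of `M` if `i = 0`, and of `Iⁱ⁻¹` if `i > 0`) is essential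
in `Iⁱ`. -/
def IsMinimalInjectiveResolution {Λ : Type u} [Ring Λ] {M : ModuleCat.{u} Λ}
    (I : InjectiveResolution M) : Prop :=
  ∀ i : ℕ, IsEssentialSubmodule (LinearMap.ker (I.cocomplex.d i (i + 1)).hom)

/-- The (left) global dimension: the supremum of the projective dimensions of left modules. -/
noncomputable def globalDimension (Λ : Type u) [Ring Λ] : WithBot ℕ∞ :=
  ⨆ M : ModuleCat.{u} Λ, projectiveDimension M

/-- The property of `Λ` that makes an Artinian algebra an `m`-Auslander algebra (for `m ≥ 1`):
`gl.dim Λ ≤ m + 1`, and the terms `I⁰(Λ), …, Iᵐ(Λ)` of a minimal injective resolution of the left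
module `Λ` are projective. -/
def IsAuslanderAlgebra (Λ : Type u) [Ring Λ] (m : ℕ) : Prop :=
  globalDimension Λ ≤ ((m + 1 : ℕ) : WithBot ℕ∞) ∧
    ∃ I : InjectiveResolution (ModuleCat.of Λ Λ), IsMinimalInjectiveResolution I ∧
      ∀ i : ℕ, i ≤ m → Projective (I.cocomplex.X i)

/-- `mod Λ`: the finitely generated left `Λ`-modules. -/
def finMod (Λ : Type u) [Ring Λ] : ObjectProperty (ModuleCat.{u} Λ) :=
  fun M => Module.Finite Λ M

section

variable {Λ : Type u} [Ring Λ]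

/-- `f : D ⟶ C` is a left `𝒞`-approximation of `D`. -/
def IsLeftApproximation (𝒞 : ObjectProperty (ModuleCat.{u} Λ)) {D C : ModuleCat.{u} Λ}
    (f : D ⟶ C) : Prop :=
  𝒞 C ∧ ∀ (C' : ModuleCat.{u} Λ), 𝒞 C' → ∀ g : D ⟶ C', ∃ h : C ⟶ C', f ≫ h = g

/-- `f : C ⟶ D` is a right `𝒞`-approximation of `D`. -/
def IsRightApproximation (𝒞 : ObjectProperty (ModuleCat.{u} Λ)) {D C : ModuleCat.{u} Λ}
    (f : C ⟶ D) : Prop :=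
  𝒞 C ∧ ∀ (C' : ModuleCat.{u} Λ), 𝒞 C' → ∀ g : C' ⟶ D, ∃ h : C' ⟶ C, h ≫ f = g

/-- `𝒞` is covariantly and contravariantly finite in `𝒟`. -/
def IsFunctoriallyFinite (𝒞 𝒟 : ObjectProperty (ModuleCat.{u} Λ)) : Prop :=
  ∀ D : ModuleCat.{u} Λ, 𝒟 D →
    (∃ (C : ModuleCat.{u} Λ) (f : D ⟶ C), IsLeftApproximation 𝒞 f) ∧
    (∃ (C : ModuleCat.{u} Λ) (f : C ⟶ D), IsRightApproximation 𝒞 f)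

/-- `^{⊥_n}𝒞`: the `X` in `mod Λ` with `Extⁱ(X, C) = 0` for all `C` in `𝒞` and `1 ≤ i ≤ n`. -/
def leftOrthogonal (n : ℕ) (𝒞 : ObjectProperty (ModuleCat.{u} Λ)) :
    ObjectProperty (ModuleCat.{u} Λ) :=
  fun X => finMod Λ X ∧ ∀ C : ModuleCat.{u} Λ, 𝒞 C → ∀ i : ℕ, 1 ≤ i → i ≤ n →
    Subsingleton (Abelian.Ext.{u} X C i)

/-- `𝒞^{⊥_n}`: the `X` in `mod Λ` with `Extⁱ(C, X) = 0` for all `C` in `𝒞` and `1 ≤ i ≤ n`. -/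
def rightOrthogonal (n : ℕ) (𝒞 : ObjectProperty (ModuleCat.{u} Λ)) :
    ObjectProperty (ModuleCat.{u} Λ) :=
  fun X => finMod Λ X ∧ ∀ C : ModuleCat.{u} Λ, 𝒞 C → ∀ i : ℕ, 1 ≤ i → i ≤ n →
    Subsingleton (Abelian.Ext.{u} C X i)

/-- `𝒞` is a maximal `n`-orthogonal subcategory of the full subcategory `𝒟` of `mod Λ`
(for `n ≥ 1`). -/
structure IsMaximalOrthogonal (n : ℕ) (𝒞 𝒟 : ObjectProperty (ModuleCat.{u} Λ)) : Prop where
  le : 𝒞 ≤ 𝒟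
  functoriallyFinite : IsFunctoriallyFinite 𝒞 𝒟
  eq_left : 𝒞 = leftOrthogonal n 𝒞 ⊓ 𝒟
  eq_right : 𝒞 = rightOrthogonal n 𝒞 ⊓ 𝒟

end

end HigherAuslander

/-! Put `d = n - 1`. Everything reduces to one equivalence, `hasInjectiveDimensionLT_iff_of_simple`:
`id S ≤ d` exactly when `S` maps trivially to every indecomposable of `𝒞` other than its envelope.
Embed `S` in a finitely generated injective `I`.

If `id S ≤ d`, dimension shifting along injectives, which lie in `𝒞`, gives `Ext¹(I/S, C) = 0` for
`C` in `𝒞`. So a nonzero `S ⟶ C` extends to `I`; by Fitting's lemma an indecomposable `C` is then a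
summand of `I` and is the envelope of `S`.

Conversely, vanishing of these maps gives `Ext¹(I/S, C) = 0`. Quotients of injectives have injective
dimension at most `d`, since `gl.dim Λ ≤ d + 1`; hence an indecomposable of `𝒞` receiving a nonzero
map from an injective is injective (`injective_of_hom_ne_zero`). Therefore maps from a quotient of
an injective to `𝒞` extend along any monomorphism into an injective, and this drives the induction
of `hasInjectiveDimensionLT_of_epi` that bounds `id (I/S)`.

The non-projective variants hold because a simple module of maximal projective dimension does not
embed in a projective. -/

namespace HigherAuslander

/-! ### Finiteness of modules with a smallest nonzero submodule -/

section EssentialExtension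

variable {R : Type*} [CommRing R] {Λ : Type*} [Ring Λ] [Algebra R Λ]
  {E : Type*} [AddCommGroup E] [Module R E] [Module Λ E] [IsScalarTower R Λ E]

/-- The submodule of elements killed by an ideal of the ground ring. -/
def idealTorsion (Λ : Type*) [Ring Λ] [Algebra R Λ] (E : Type*) [AddCommGroup E] [Module R E]
    [Module Λ E] [IsScalarTower R Λ E] (I : Ideal R) : Submodule Λ E where
  carrier := {x | ∀ r ∈ I, r • x = 0}
  zero_mem' := by simp
  add_mem' := by
    intro a b ha hb r hr
    rw [smul_add, ha r hr, hb r hr, add_zero]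
  smul_mem' := by
    intro l x hx r hr
    have := IsScalarTower.to_smulCommClass (R := R) (A := Λ) (M := E)
    rw [smul_comm, hx r hr, smul_zero]

/-- Since `r` is central, `rS` is a submodule; being nonzero, it contains the smallest one. -/
theorem exists_mem_of_smul_ne_zero {S : Submodule Λ E} (h : ∀ N : Submodule Λ E, N ≠ ⊥ → S ≤ N)
    {r : R} {t : E} (ht : t ∈ S) (hrt : r • t ≠ 0) {s : E} (hs : s ∈ S) :
    ∃ s' ∈ S, r • s' = s := by
  have := IsScalarTower.to_smulCommClass (R := R) (A := Λ) (M := E)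
  have hN : S.map (DistribSMul.toLinearMap Λ E r) ≠ ⊥ := by
    intro h0
    apply hrt
    have : r • t ∈ S.map (DistribSMul.toLinearMap Λ E r) := ⟨t, ht, rfl⟩
    simpa [h0] using this
  obtain ⟨s', hs', rfl⟩ := h _ hN hs
  exact ⟨s', hs', rfl⟩

theorem isPrime_annihilator {S : Submodule Λ E} (hS : S ≠ ⊥)
    (h : ∀ N : Submodule Λ E, N ≠ ⊥ → S ≤ N) :
    (S.restrictScalars R).annihilator.IsPrime := by
  refine ⟨?_, ?_⟩
  · intro htop
    apply hS
    rw [eq_bot_iff]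
    intro s hs
    have h1 : (1 : R) ∈ (S.restrictScalars R).annihilator := htop ▸ Submodule.mem_top
    simpa using Submodule.mem_annihilator.1 h1 s hs
  · intro a b hab
    by_contra! hcon
    obtain ⟨ha, hb⟩ := hcon
    apply ha
    rw [Submodule.mem_annihilator]
    intro s hs
    have : ∃ t ∈ S, b • t ≠ 0 := by
      by_contra! hc
      exact hb (Submodule.mem_annihilator.2 hc)
    obtain ⟨t, ht, hbt⟩ := this
    obtain ⟨s', hs', rfl⟩ := exists_mem_of_smul_ne_zero h ht hbt hs
    rw [smul_smul]
    exact Submodule.mem_annihilator.1 hab s' hs'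

/-- The annihilator `m` is maximal, so some `R/m`-linear form `φ` on the `m`-torsion is nonzero at a
chosen `s ∈ S`. With `g i` generating `Λ` over `R`, the map `x ↦ (φ (g i • x))` is injective: if it
kills `x`, then `φ` vanishes on `Λx`, which would contain `s` if `x ≠ 0`. -/
theorem isNoetherian_idealTorsion_annihilator [IsArtinianRing R] [Module.Finite R Λ]
    {S : Submodule Λ E} (hS : S ≠ ⊥) (h : ∀ N : Submodule Λ E, N ≠ ⊥ → S ≤ N) :
    IsNoetherian R (idealTorsion Λ E (S.restrictScalars R).annihilator) := by
  set m := (S.restrictScalars R).annihilator with hm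
  have hp : m.IsPrime := isPrime_annihilator hS h
  have hmax : m.IsMaximal := (IsArtinianRing.isPrime_iff_isMaximal m).1 hp
  let _ : Field (R ⧸ m) := Ideal.Quotient.field m
  obtain ⟨s, hs, hs0⟩ := Submodule.exists_mem_ne_zero_of_ne_bot hS
  let T := idealTorsion Λ E m
  have hT : Module.IsTorsionBySet R T m := fun x r => Subtype.ext (x.2 r.1 r.2)
  let _ : Module (R ⧸ m) T := hT.module
  have hST : S ≤ T := fun x hx r hr => Submodule.mem_annihilator.1 hr x hx
  obtain ⟨φ, hφ⟩ := Module.Projective.exists_dual_ne_zero (R ⧸ m) (x := (⟨s, hST hs⟩ : T))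
    (by simpa [Subtype.ext_iff] using hs0)
  have hφsmul : ∀ (r : R) (x : T), φ (r • x) = r • φ x := by
    intro r x
    have : r • x = (Ideal.Quotient.mk m r) • x := (hT.mk_smul r x).symm
    rw [this, map_smul]
    rfl
  obtain ⟨k, g, hg⟩ := Module.Finite.exists_fin (R := R) (M := Λ)
  let ψ : T →ₗ[R] (Fin k → R ⧸ m) :=
    { toFun := fun x i => φ (g i • x)
      map_add' := fun x y => by ext i; simp
      map_smul' := fun r x => by
        have := IsScalarTower.to_smulCommClass (R := R) (A := Λ) (M := T)
        ext i
        simp only [RingHom.id_apply, Pi.smul_apply]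
        rw [smul_comm, hφsmul] }
  have hψ : Function.Injective ψ := by
    rw [← LinearMap.ker_eq_bot, eq_bot_iff]
    intro x hx
    have hx' : ∀ l : Λ, φ (l • x) = 0 := by
      intro l
      have hl : l ∈ Submodule.span R (Set.range g) := hg ▸ Submodule.mem_top
      induction hl using Submodule.span_induction with
      | mem y hy =>
        obtain ⟨i, rfl⟩ := hy
        exact congrFun (LinearMap.mem_ker.1 hx) i
      | zero => simp
      | add a b _ _ ha hb => rw [add_smul, map_add, ha, hb, add_zero]
      | smul r a _ ha => rw [smul_assoc, hφsmul, ha, smul_zero]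
    by_contra hx0
    have hN : Submodule.span Λ {(x : E)} ≠ ⊥ := by
      simpa [Submodule.span_singleton_eq_bot] using hx0
    obtain ⟨l, hl⟩ := Submodule.mem_span_singleton.1 (h _ hN hs)
    apply hφ
    rw [← hx' l]
    congr 1
    exact Subtype.ext hl.symm
  exact isNoetherian_of_injective ψ hψ

theorem isNoetherian_idealTorsion_pow [IsArtinianRing R] {I : Ideal R}
    (hI : IsNoetherian R (idealTorsion Λ E I)) (k : ℕ) :
    IsNoetherian R (idealTorsion Λ E (I ^ k)) := by
  induction k with
  | zero =>
    have : Subsingleton (idealTorsion Λ E (I ^ 0)) := by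
      refine ⟨fun x y => Subtype.ext ?_⟩
      have hx := x.2 1 (by simp)
      have hy := y.2 1 (by simp)
      rw [one_smul] at hx hy
      rw [hx, hy]
    infer_instance
  | succ k ih =>
    obtain ⟨d, g, hg⟩ := Submodule.fg_iff_exists_fin_generating_family.1
      (IsNoetherian.noetherian I)
    have hgI : ∀ j, g j ∈ I := fun j => hg ▸ Submodule.subset_span ⟨j, rfl⟩
    -- Multiplication by generators of `I` lands in the `I ^ k`-torsion, and its kernel is the
    -- `I`-torsion.
    let f : idealTorsion Λ E (I ^ (k + 1)) →ₗ[R] (Fin d → idealTorsion Λ E (I ^ k)) :=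
      { toFun := fun x j => ⟨g j • (x : E), fun r hr => by
          rw [smul_smul]
          exact x.2 _ (by rw [pow_succ]; exact Ideal.mul_mem_mul hr (hgI j))⟩
        map_add' := fun x y => by ext j; simp
        map_smul' := fun r x => by ext j; simp [smul_comm r] }
    let e : LinearMap.ker f →ₗ[R] idealTorsion Λ E I :=
      { toFun := fun x => ⟨x.1.1, by
          intro r hr
          rw [← hg] at hr
          have hx : ∀ j, g j • (x.1.1 : E) = 0 := fun j =>
            congrArg Subtype.val (congrFun (LinearMap.mem_ker.1 x.2) j)
          induction hr using Submodule.span_induction with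
          | mem y hy => obtain ⟨j, rfl⟩ := hy; exact hx j
          | zero => simp
          | add a b _ _ ha hb => rw [add_smul, ha, hb, add_zero]
          | smul r a _ ha => rw [smul_assoc, ha, smul_zero]⟩
        map_add' := fun x y => rfl
        map_smul' := fun r x => rfl }
    have he : Function.Injective e := by
      intro x y hxy
      have h0 : (e x : E) = e y := congrArg Subtype.val hxy
      exact Subtype.ext (Subtype.ext h0)
    have : IsNoetherian R (LinearMap.ker f) := isNoetherian_of_injective e he
    exact isNoetherian_of_range_eq_ker (LinearMap.ker f).subtype f (by simp)

/-- A module over an Artin algebra with a smallest nonzero submodule has finite length. -/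
theorem finite_of_le_of_ne_bot [IsArtinianRing R] [Module.Finite R Λ]
    {S : Submodule Λ E} (hS : S ≠ ⊥) (h : ∀ N : Submodule Λ E, N ≠ ⊥ → S ≤ N) :
    Module.Finite Λ E := by
  have := IsScalarTower.to_smulCommClass (R := R) (A := Λ) (M := E)
  set m := (S.restrictScalars R).annihilator with hm
  obtain ⟨N, hN⟩ := IsArtinian.monotone_stabilizes
    (⟨fun k => OrderDual.toDual (m ^ k), fun a b hab => Ideal.pow_le_pow_right hab⟩ :
      ℕ →o (Ideal R)ᵒᵈ)
  have hN' : ∀ k, N ≤ k → m ^ N = m ^ k := fun k hk => hN k hk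
  -- The exponent `N + 1` rather than `N` is positive, so that the idempotent generator `e` lies in
  -- `m`.
  have hid : IsIdempotentElem (m ^ (N + 1)) := by
    unfold IsIdempotentElem
    rw [← pow_add, ← hN' (N + 1) (by omega), ← hN' _ (by omega)]
  obtain ⟨e, he, hme⟩ := (Ideal.isIdempotentElem_iff_of_fg _ (IsNoetherian.noetherian _)).1 hid
  have hem : e ∈ m := by
    have : e ∈ m ^ (N + 1) := hme ▸ Submodule.mem_span_singleton_self e
    exact Ideal.pow_le_self (by omega) this
  -- If `eE ≠ 0` then `S ≤ eE`, where `e` acts as the identity; but `e ∈ m` kills `S`.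
  have heE : ∀ x : E, e • x = 0 := by
    by_contra! hc
    obtain ⟨x, hx⟩ := hc
    have hr : LinearMap.range (DistribSMul.toLinearMap Λ E e) ≠ ⊥ := by
      intro h0
      apply hx
      have : e • x ∈ LinearMap.range (DistribSMul.toLinearMap Λ E e) := ⟨x, rfl⟩
      simpa [h0] using this
    apply hS
    rw [eq_bot_iff]
    intro s hs
    obtain ⟨y, rfl⟩ := h _ hr hs
    have h1 : e • (e • y) = 0 := Submodule.mem_annihilator.1 hem _ hs
    rw [smul_smul, he.eq] at h1
    exact h1
  have htop : idealTorsion Λ E (m ^ (N + 1)) = ⊤ := by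
    rw [eq_top_iff]
    intro x _ r hr
    rw [hme] at hr
    obtain ⟨a, rfl⟩ := Submodule.mem_span_singleton.1 hr
    rw [smul_assoc, heE, smul_zero]
  have h1 := isNoetherian_idealTorsion_pow
    (isNoetherian_idealTorsion_annihilator (R := R) hS h) (N + 1)
  have h2 : Module.Finite Λ (idealTorsion Λ E (m ^ (N + 1))) :=
    Module.Finite.of_restrictScalars_finite R Λ _
  rw [htop] at h2
  exact Module.Finite.equiv Submodule.topEquiv

end EssentialExtension

/-! ### Embeddings into finitely generated injectives -/

section InjectiveEmbedding

/-- An injective module containing a simple submodule `S` has a direct summand (the image of an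
idempotent endomorphism) which is an essential extension of `S`. -/
theorem exists_injective_le_of_ne_bot {Λ : Type u} [Ring Λ] {J : Type u} [AddCommGroup J]
    [Module Λ J] (hJ : Injective (ModuleCat.of Λ J)) (S : Submodule Λ J) (hS : IsAtom S) :
    ∃ E : Submodule Λ J, S ≤ E ∧ (∀ N ≤ E, N ≠ ⊥ → S ≤ N) ∧ Injective (ModuleCat.of Λ E) := by
  obtain ⟨E, hSE, hE⟩ := zorn_le_nonempty₀ {E : Submodule Λ J | ∀ N ≤ E, N ≠ ⊥ → S ≤ N}
    (by
      intro c hc hchain y hy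
      refine ⟨sSup c, ?_, fun z hz => le_sSup hz⟩
      intro N hN hN0
      obtain ⟨x, hx, hx0⟩ := Submodule.exists_mem_ne_zero_of_ne_bot hN0
      obtain ⟨z, hz, hxz⟩ := (Submodule.mem_sSup_of_directed ⟨y, hy⟩ hchain.directedOn).1 (hN hx)
      have h1 : S ≤ Submodule.span Λ {x} := hc hz _ (by simpa using hxz) (by simpa using hx0)
      exact h1.trans (by simpa using hx))
    S (by
      intro N hN hN0
      exact ((hS.le_iff_eq hN0).1 hN).ge)
  have hEP : ∀ N ≤ E, N ≠ ⊥ → S ≤ N := hE.prop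
  -- With `P` maximal among submodules disjoint from `E`, the inclusion of `E` extends from `E ↪
  -- J/P` to `h : J/P ⟶ J`. Maximality of `E` forces the image of `h` into `E`, which makes `E` a
  -- retract.
  obtain ⟨P, -, hP⟩ := zorn_le_nonempty₀ {P : Submodule Λ J | Disjoint P E}
    (by
      intro c hc hchain y hy
      refine ⟨sSup c, ?_, fun z hz => le_sSup hz⟩
      change Disjoint _ _
      rw [Submodule.disjoint_def]
      intro x hx hxE
      obtain ⟨z, hz, hxz⟩ := (Submodule.mem_sSup_of_directed ⟨y, hy⟩ hchain.directedOn).1 hx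
      exact Submodule.disjoint_def.1 (hc hz) x hxz hxE)
    ⊥ disjoint_bot_left
  have hPE : Disjoint P E := hP.prop
  have hinj : Function.Injective (P.mkQ.comp E.subtype) := by
    rw [← LinearMap.ker_eq_bot, eq_bot_iff]
    intro x hx
    have : (x : J) ∈ P := by simpa using hx
    exact Subtype.ext (Submodule.disjoint_def.1 hPE x this x.2)
  have hJ' := Module.injective_module_of_injective_object (inj := hJ)
  obtain ⟨h, hh⟩ := hJ'.out _ hinj E.subtype
  have hhE : ∀ x ∈ E, h (P.mkQ x) = x := fun x hx => hh ⟨x, hx⟩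
  have hker : LinearMap.ker (h.comp P.mkQ) ≤ P := by
    apply hP.le_of_ge
    · change Disjoint _ _
      rw [Submodule.disjoint_def]
      intro x hx hxE
      rw [← hhE x hxE]
      exact hx
    · intro x hx
      have : P.mkQ x = 0 := by simpa using hx
      rw [LinearMap.mem_ker, LinearMap.comp_apply, this, map_zero]
  have hrange : LinearMap.range (h.comp P.mkQ) ≤ E := by
    apply hE.le_of_ge
    · intro N hN hN0
      by_contra hSN
      have hdis : Disjoint (N.comap (h.comp P.mkQ)) E := by
        rw [Submodule.disjoint_def]
        intro x hx hxE
        have hxN : x ∈ N := by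
          have : h (P.mkQ x) ∈ N := hx
          rwa [hhE x hxE] at this
        by_contra hx0
        apply hSN
        refine (hEP (Submodule.span Λ {x}) (by simpa using hxE) (by simpa using hx0)).trans ?_
        simpa using hxN
      have hle : N.comap (h.comp P.mkQ) ≤ P := by
        apply hP.le_of_ge hdis
        intro x hx
        have : P.mkQ x = 0 := by simpa using hx
        rw [Submodule.mem_comap, LinearMap.comp_apply, this, map_zero]
        exact N.zero_mem
      apply hN0
      rw [eq_bot_iff]
      intro y hy
      obtain ⟨x, rfl⟩ := hN hy
      have hx : x ∈ P := hle hy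
      have : P.mkQ x = 0 := by simpa using hx
      simp only [LinearMap.comp_apply, this, map_zero, Submodule.mem_bot]
    · intro x hx
      exact ⟨x, hhE x hx⟩
  refine ⟨E, hSE, hEP, ?_⟩
  let r : Retract (ModuleCat.of Λ E) (ModuleCat.of Λ J) :=
    { i := ModuleCat.ofHom E.subtype
      r := ModuleCat.ofHom ((h.comp P.mkQ).codRestrict E fun x => hrange ⟨x, rfl⟩)
      retract := by
        ext x
        exact hhE x x.2 }
  exact r.injective

/-- A simple module over an Artin algebra embeds into a finitely generated injective module. -/
theorem exists_finite_injective_of_isSimpleModule {R : Type*} [CommRing R] [IsArtinianRing R]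
    {Λ : Type u} [Ring Λ] [Algebra R Λ] [Module.Finite R Λ]
    (S : Type u) [AddCommGroup S] [Module Λ S] [IsSimpleModule Λ S] :
    ∃ (I : ModuleCat.{u} Λ) (f : S →ₗ[Λ] I), Module.Finite Λ I ∧ Injective I ∧
      Function.Injective f := by
  let J := Injective.under (ModuleCat.of Λ S)
  let ι : S →ₗ[Λ] J := (Injective.ι (ModuleCat.of Λ S)).hom
  have hι : Function.Injective ι :=
    (ModuleCat.mono_iff_injective (Injective.ι (ModuleCat.of Λ S))).1 inferInstance
  have hat : IsAtom (LinearMap.range ι) := by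
    rw [← isSimpleModule_iff_isAtom]
    exact IsSimpleModule.congr (LinearEquiv.ofInjective ι hι).symm
  obtain ⟨E, hSE, hE, hEinj⟩ := exists_injective_le_of_ne_bot (J := J)
    (inferInstanceAs (Injective J)) _ hat
  let g : S →ₗ[Λ] E := ι.codRestrict E fun x => hSE ⟨x, rfl⟩
  have hg : Function.Injective g := fun x y hxy => hι (congrArg Subtype.val hxy)
  refine ⟨ModuleCat.of Λ E, g, ?_, hEinj, hg⟩
  let _ : Module R E := Module.compHom E (algebraMap R Λ)
  have : IsScalarTower R Λ E := IsScalarTower.of_algebraMap_smul fun _ _ => rfl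
  refine finite_of_le_of_ne_bot (R := R) (S := LinearMap.range g) ?_ ?_
  · intro h0
    have := IsSimpleModule.nontrivial Λ S
    obtain ⟨x, hx⟩ := exists_ne (0 : S)
    apply hx
    apply hg
    rw [LinearMap.range_eq_bot.1 h0]
    rfl
  · intro N hN
    have h1 : N.map E.subtype ≠ ⊥ := by
      intro h0
      exact hN (Submodule.map_injective_of_injective E.injective_subtype
        (h0.trans (Submodule.map_bot _).symm))
    rintro _ ⟨x, rfl⟩
    obtain ⟨y, hy, hyx⟩ := hE _ (Submodule.map_subtype_le E N) h1 ⟨x, rfl⟩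
    have : y = g x := Subtype.ext hyx
    rwa [← this]

theorem exists_finite_injective_of_isFiniteLength {R : Type*} [CommRing R] [IsArtinianRing R]
    {Λ : Type u} [Ring Λ] [Algebra R Λ] [Module.Finite R Λ]
    (M : Type u) [AddCommGroup M] [Module Λ M] (hM : IsFiniteLength Λ M) :
    ∃ (I : ModuleCat.{u} Λ) (f : M →ₗ[Λ] I), Module.Finite Λ I ∧ Injective I ∧
      Function.Injective f := by
  induction hM with
  | of_subsingleton =>
    exact ⟨ModuleCat.of Λ PUnit, 0, inferInstance,
      (ModuleCat.isZero_of_subsingleton _).injective, fun _ _ _ => Subsingleton.elim _ _⟩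
  | @of_simple_quotient M _ _ N _ _ ih =>
    obtain ⟨I, f, hI, hIinj, hf⟩ := ih
    obtain ⟨I', f', hI', hIinj', hf'⟩ :=
      exists_finite_injective_of_isSimpleModule (R := R) (Λ := Λ) (M ⧸ N)
    have hImod := Module.injective_module_of_injective_object (R := Λ) (M := I)
      (inj := hIinj)
    -- Extend the embedding of `N` to `M` and pair it with the embedding of `M ⧸ N`: the second
    -- detects elements outside `N`, the first those inside.
    obtain ⟨g, hg⟩ := hImod.out N.subtype N.injective_subtype f
    refine ⟨I ⊞ I', (ModuleCat.biprodIsoProd I I').inv.hom ∘ₗ (g.prod (f' ∘ₗ N.mkQ)),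
      Module.Finite.equiv (ModuleCat.biprodIsoProd I I').symm.toLinearEquiv, inferInstance, ?_⟩
    refine (ModuleCat.biprodIsoProd I I').symm.toLinearEquiv.injective.comp ?_
    rw [← LinearMap.ker_eq_bot, eq_bot_iff]
    intro x hx
    have hx' := LinearMap.mem_ker.1 hx
    have h1 : g x = 0 := congrArg Prod.fst hx'
    have h2 : f' (N.mkQ x) = 0 := congrArg Prod.snd hx'
    have hxN : x ∈ N := by
      have := hf' (h2.trans (map_zero f').symm)
      simpa using this
    have := (hg ⟨x, hxN⟩).symm.trans h1
    have h3 := hf (this.trans (map_zero f).symm)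
    exact congrArg Subtype.val h3

end InjectiveEmbedding

section FiniteLength

theorem isFiniteLength_of_finite (R : Type*) [CommRing R] [IsArtinianRing R]
    {Λ : Type*} [Ring Λ] [Algebra R Λ] [Module.Finite R Λ]
    (M : Type*) [AddCommGroup M] [Module Λ M] [Module.Finite Λ M] : IsFiniteLength Λ M := by
  have h1 : IsNoetherian R Λ := inferInstance
  have h2 : IsArtinian R Λ := inferInstance
  have h3 : IsNoetherianRing Λ := isNoetherian_of_tower R h1
  have h4 : IsArtinianRing Λ := isArtinian_of_tower R h2
  exact isFiniteLength_iff_isNoetherian_isArtinian.2 ⟨inferInstance, inferInstance⟩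

/-- The finitely generated modules over an Artin algebra have enough injectives. -/
theorem exists_mono_finite_injective (R : Type*) [CommRing R] [IsArtinianRing R]
    {Λ : Type u} [Ring Λ] [Algebra R Λ] [Module.Finite R Λ] (X : ModuleCat.{u} Λ)
    (hX : finMod Λ X) :
    ∃ (I : ModuleCat.{u} Λ) (f : X ⟶ I), finMod Λ I ∧ Injective I ∧ Mono f := by
  have : Module.Finite Λ X := hX
  obtain ⟨I, f, hI, hIinj, hf⟩ := exists_finite_injective_of_isFiniteLength (R := R) (Λ := Λ) X
    (isFiniteLength_of_finite R X)
  exact ⟨I, ModuleCat.ofHom f, hI, hIinj, (ModuleCat.mono_iff_injective _).2 hf⟩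

end FiniteLength

/-! ### Indecomposable modules of finite length -/

section Indecomposable

variable {Λ : Type u} [Ring Λ]

/-- Fitting: an endomorphism of an indecomposable module of finite length that fixes a nonzero
element is bijective. -/
theorem bijective_of_indecomposable {C : ModuleCat.{u} Λ} (hC : IsFiniteLength Λ C)
    (hind : Indecomposable C) (φ : C →ₗ[Λ] C) {x : C} (hx : x ≠ 0) (hφ : φ x = x) :
    Function.Bijective φ := by
  obtain ⟨_, _⟩ := isFiniteLength_iff_isNoetherian_isArtinian.1 hC
  have hcompl := φ.isCompl_iSup_ker_pow_iInf_range_pow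
  set A : Submodule Λ C := ⨆ n, LinearMap.ker (φ ^ n) with hA
  set B : Submodule Λ C := ⨅ n, LinearMap.range (φ ^ n) with hB
  have hxn : ∀ n : ℕ, (φ ^ n) x = x := by
    intro n
    induction n with
    | zero => simp
    | succ n ih => rw [pow_succ, Module.End.mul_apply, hφ, ih]
  have hxB : x ∈ B := (Submodule.mem_iInf _).2 fun n => ⟨x, hxn n⟩
  -- In the Fitting decomposition the fixed element lies in `B`, so indecomposability kills `A`,
  -- which contains the kernel.
  let e : C ≅ ModuleCat.of Λ A ⊞ ModuleCat.of Λ B :=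
    (Submodule.prodEquivOfIsCompl A B hcompl).symm.toModuleIso ≪≫
      (ModuleCat.biprodIsoProd (ModuleCat.of Λ A) (ModuleCat.of Λ B)).symm
  have hA0 : A = ⊥ := by
    rcases hind.2 _ _ e with h | h
    · have := ModuleCat.subsingleton_of_isZero h
      exact Submodule.subsingleton_iff_eq_bot.1 this
    · have := ModuleCat.subsingleton_of_isZero h
      exact absurd (congrArg Subtype.val (Subsingleton.elim (⟨x, hxB⟩ : B) 0)) hx
  have hker : LinearMap.ker φ = ⊥ := by
    rw [eq_bot_iff, ← hA0]
    have := le_iSup (fun n => LinearMap.ker (φ ^ n)) 1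
    simpa using this
  exact IsArtinian.bijective_of_injective_endomorphism φ (LinearMap.ker_eq_bot.1 hker)

theorem isIso_of_indecomposable {C X : ModuleCat.{u} Λ} (hC : IsFiniteLength Λ C)
    (hind : Indecomposable C) (φ : C ⟶ C) {g : X ⟶ C} (hg : g ≠ 0) (hφ : g ≫ φ = g) :
    IsIso φ := by
  have : ∃ x, g x ≠ 0 := by
    by_contra! h
    exact hg (by ext x; exact h x)
  obtain ⟨x, hx⟩ := this
  have := bijective_of_indecomposable hC hind φ.hom hx
    (by rw [← ConcreteCategory.comp_apply, hφ])
  exact (ConcreteCategory.isIso_iff_bijective φ).2 this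

/-- If a nonzero subobject `X` of an indecomposable `C` of finite length extends along an embedding
of `X` into an injective module, then `C` is injective. -/
theorem injective_of_factors {C X I : ModuleCat.{u} Λ} (hC : IsFiniteLength Λ C)
    (hind : Indecomposable C) [Injective I] (g : X ⟶ C) [Mono g] (hg : g ≠ 0) (i : X ⟶ I)
    (h : I ⟶ C) (hh : i ≫ h = g) : Injective C := by
  let k : C ⟶ I := Injective.factorThru i g
  have hk : g ≫ k = i := Injective.comp_factorThru i g
  have := isIso_of_indecomposable hC hind (k ≫ h) hg (by rw [← Category.assoc, hk, hh])
  let r : Retract C I := ⟨k, h ≫ inv (k ≫ h), by rw [← Category.assoc, IsIso.hom_inv_id]⟩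
  exact r.injective

/-- Every nonzero submodule of an indecomposable injective module of finite length is essential. -/
theorem isInjectiveEnvelope_of_indecomposable {C X : ModuleCat.{u} Λ} (hC : IsFiniteLength Λ C)
    (hind : Indecomposable C) [hinj : Injective C] (g : X ⟶ C) [hmono : Mono g] (hg : g ≠ 0) :
    IsInjectiveEnvelope g := by
  refine ⟨hmono, hinj, fun N hN hNg => ?_⟩
  let q : C ⟶ ModuleCat.of Λ (C ⧸ N) := ModuleCat.ofHom N.mkQ
  -- If `N` misses the image of `g`, then `X` embeds in `C/N`, and `g` extends to `C/N`. The
  -- resulting endomorphism of `C` fixes `g`, so it is invertible, yet it kills `N`.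
  have hq : Mono (g ≫ q) := by
    rw [ModuleCat.mono_iff_injective, ← LinearMap.coe_coe, ← LinearMap.ker_eq_bot, eq_bot_iff]
    intro x hx
    have h1 : g x ∈ N := (Submodule.Quotient.mk_eq_zero N).1 hx
    have h2 : g x ∈ N ⊓ LinearMap.range g.hom := ⟨h1, ⟨x, rfl⟩⟩
    rw [hNg] at h2
    exact (ModuleCat.mono_iff_injective g).1 hmono (h2.trans (map_zero g.hom).symm)
  let k : ModuleCat.of Λ (C ⧸ N) ⟶ C := Injective.factorThru g (g ≫ q)
  have hk : g ≫ q ≫ k = g := by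
    rw [← Category.assoc]; exact Injective.comp_factorThru g (g ≫ q)
  have := isIso_of_indecomposable hC hind (q ≫ k) hg hk
  have hb := ((ConcreteCategory.isIso_iff_bijective (q ≫ k)).1 this).1
  apply hN
  rw [eq_bot_iff]
  intro x hx
  apply hb
  have : q x = 0 := (Submodule.Quotient.mk_eq_zero N).2 hx
  rw [ConcreteCategory.comp_apply, this, map_zero, map_zero]

/-- Induction over direct sum decompositions of modules of finite length. -/
theorem indecomposable_induction {Q : ModuleCat.{u} Λ → Prop}
    (zero : ∀ Y, Limits.IsZero Y → Q Y) (indec : ∀ Y, Indecomposable Y → Q Y)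
    (sum : ∀ Y Z W : ModuleCat.{u} Λ, (W ≅ Y ⊞ Z) → Q Y → Q Z → Q W)
    (X : ModuleCat.{u} Λ) (hX : IsFiniteLength Λ X) : Q X := by
  obtain ⟨d, hd⟩ := ENat.ne_top_iff_exists.1 (Module.length_ne_top_iff.2 hX)
  induction d using Nat.strong_induction_on generalizing X with
  | _ d ih =>
    by_cases h0 : Limits.IsZero X
    · exact zero X h0
    by_cases hind : Indecomposable X
    · exact indec X hind
    have : ∃ (Y Z : ModuleCat.{u} Λ) (_ : X ≅ Y ⊞ Z), ¬ Limits.IsZero Y ∧ ¬ Limits.IsZero Z := by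
      by_contra! hc
      exact hind ⟨h0, fun Y Z e => or_iff_not_imp_left.2 (hc Y Z e)⟩
    obtain ⟨Y, Z, e, hY, hZ⟩ := this
    have hlen : Module.length Λ X = Module.length Λ Y + Module.length Λ Z := by
      rw [← Module.length_prod]
      exact (e ≪≫ ModuleCat.biprodIsoProd Y Z).toLinearEquiv.length_eq
    have hYf : IsFiniteLength Λ Y := by
      refine Module.length_ne_top_iff.1 fun h => ?_
      rw [h, top_add, ← hd] at hlen
      exact ENat.natCast_ne_top _ hlen
    have hZf : IsFiniteLength Λ Z := by
      refine Module.length_ne_top_iff.1 fun h => ?_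
      rw [h, add_top, ← hd] at hlen
      exact ENat.natCast_ne_top _ hlen
    obtain ⟨a, ha⟩ := ENat.ne_top_iff_exists.1 (Module.length_ne_top_iff.2 hYf)
    obtain ⟨b, hb⟩ := ENat.ne_top_iff_exists.1 (Module.length_ne_top_iff.2 hZf)
    have hab : d = a + b := by
      rw [← hd, ← ha, ← hb] at hlen
      exact_mod_cast hlen
    have ha0 : a ≠ 0 := by
      rintro rfl
      have := Module.length_eq_zero_iff.1 ha.symm
      exact hY (ModuleCat.isZero_of_subsingleton Y)
    have hb0 : b ≠ 0 := by
      rintro rfl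
      have := Module.length_eq_zero_iff.1 hb.symm
      exact hZ (ModuleCat.isZero_of_subsingleton Z)
    exact sum Y Z X e (ih a (by omega) Y hYf ha) (ih b (by omega) Z hZf hb)

end Indecomposable

/-! ### Vanishing of Ext along short exact sequences -/

section ExtSequences

universe w v

theorem shortExact_cokernel {A : Type u} [Category.{v} A] [Abelian A] {X I : A} (f : X ⟶ I) [Mono f] :
    (ShortComplex.mk f (Limits.cokernel.π f) (Limits.cokernel.condition f)).ShortExact :=
  { exact := ShortComplex.exact_cokernel f }

open Abelian

variable {A : Type u} [Category.{v} A] [Abelian A] [HasExt.{w} A] {T : ShortComplex A}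

theorem subsingleton_ext_X₁ (hT : T.ShortExact) (Y : A) (i : ℕ)
    (h₂ : Subsingleton (Ext.{w} T.X₂ Y i)) (h₃ : Subsingleton (Ext.{w} T.X₃ Y (i + 1))) :
    Subsingleton (Ext.{w} T.X₁ Y i) := by
  refine subsingleton_of_forall_eq 0 fun x => ?_
  obtain ⟨y, rfl⟩ := Ext.contravariant_sequence_exact₁ hT Y x (add_comm 1 i)
    (Subsingleton.elim _ _)
  rw [Subsingleton.elim y 0, Ext.comp_zero]

theorem subsingleton_ext_X₃ (hT : T.ShortExact) (Y : A) (i : ℕ)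
    (h₁ : Subsingleton (Ext.{w} T.X₁ Y i)) (h₂ : Subsingleton (Ext.{w} T.X₂ Y (i + 1))) :
    Subsingleton (Ext.{w} T.X₃ Y (i + 1)) := by
  refine subsingleton_of_forall_eq 0 fun x => ?_
  obtain ⟨y, rfl⟩ := Ext.contravariant_sequence_exact₃ hT Y x (Subsingleton.elim _ _)
    (add_comm 1 i)
  rw [Subsingleton.elim y 0, Ext.comp_zero]

theorem exists_factor_of_subsingleton_ext_one (hT : T.ShortExact) {Y : A}
    (h₃ : Subsingleton (Ext.{w} T.X₃ Y 1)) (g : T.X₁ ⟶ Y) : ∃ h : T.X₂ ⟶ Y, T.f ≫ h = g := by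
  obtain ⟨y, hy⟩ := Ext.contravariant_sequence_exact₁ hT Y (Ext.mk₀ g) (add_zero 1)
    (Subsingleton.elim _ _)
  obtain ⟨h, rfl⟩ := (Ext.mk₀_bijective _ _).2 y
  refine ⟨h, (Ext.mk₀_bijective _ _).1 ?_⟩
  rw [← hy, Ext.mk₀_comp_mk₀]

theorem subsingleton_ext_one_X₃ (hT : T.ShortExact) {Y : A}
    (h : ∀ g : T.X₁ ⟶ Y, ∃ h : T.X₂ ⟶ Y, T.f ≫ h = g) (h₂ : Subsingleton (Ext.{w} T.X₂ Y 1)) :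
    Subsingleton (Ext.{w} T.X₃ Y 1) := by
  refine subsingleton_of_forall_eq 0 fun x => ?_
  obtain ⟨y, rfl⟩ := Ext.contravariant_sequence_exact₃ hT Y x (Subsingleton.elim _ _)
    (add_zero 1)
  obtain ⟨g, rfl⟩ := (Ext.mk₀_bijective _ _).2 y
  obtain ⟨k, rfl⟩ := h g
  -- The class is the connecting image of `g`; as `g` extends over `T.X₂`, it is zero.
  rw [← Ext.mk₀_comp_mk₀, ← Ext.comp_assoc_of_second_deg_zero, hT.extClass_comp, Ext.zero_comp]

theorem subsingleton_ext_of_retract_left {X Y : A} (r : Retract X Y) (Z : A) (i : ℕ)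
    (h : Subsingleton (Ext.{w} Y Z i)) : Subsingleton (Ext.{w} X Z i) := by
  refine subsingleton_of_forall_eq 0 fun x => ?_
  have h1 : (Ext.mk₀ r.i).comp ((Ext.mk₀ r.r).comp x (zero_add i)) (zero_add i) = x := by
    rw [Ext.mk₀_comp_mk₀_assoc, r.retract, Ext.mk₀_id_comp]
  rw [← h1, Subsingleton.elim ((Ext.mk₀ r.r).comp x (zero_add i)) 0, Ext.comp_zero]

end ExtSequences

/-- `mod Λ` consists of modules of finite length and has enough injectives. -/
structure FinModHasEnoughInjectives (Λ : Type u) [Ring Λ] : Prop where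
  isFiniteLength : ∀ X : ModuleCat.{u} Λ, finMod Λ X → IsFiniteLength Λ X
  exists_mono : ∀ X : ModuleCat.{u} Λ, finMod Λ X →
    ∃ (I : ModuleCat.{u} Λ) (f : X ⟶ I), finMod Λ I ∧ Injective I ∧ Mono f

theorem finModHasEnoughInjectives (R : Type*) [CommRing R] [IsArtinianRing R]
    (Λ : Type u) [Ring Λ] [Algebra R Λ] [Module.Finite R Λ] : FinModHasEnoughInjectives Λ where
  isFiniteLength X hX := by
    have : Module.Finite Λ X := hX
    exact isFiniteLength_of_finite R X
  exists_mono := exists_mono_finite_injective R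

section

variable {Λ : Type u} [Ring Λ]

theorem finMod_of_epi {X Y : ModuleCat.{u} Λ} (f : X ⟶ Y) [hf : Epi f] (hX : finMod Λ X) :
    finMod Λ Y := by
  have : Module.Finite Λ X := hX
  exact Module.Finite.of_surjective f.hom ((ModuleCat.epi_iff_surjective f).1 hf)

theorem finMod_of_retract {X Y : ModuleCat.{u} Λ} (r : Retract X Y) (hY : finMod Λ Y) :
    finMod Λ X :=
  finMod_of_epi r.r hY

end

/-! ### Injective dimension and maps into a maximal orthogonal subcategory -/

namespace IsMaximalOrthogonal

variable {Λ : Type u} [Ring Λ] {d : ℕ} {𝒞 : ObjectProperty (ModuleCat.{u} Λ)}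
  (h : IsMaximalOrthogonal d 𝒞 (finMod Λ))

include h

theorem mem_iff_left (X : ModuleCat.{u} Λ) : 𝒞 X ↔ leftOrthogonal d 𝒞 X := by
  rw [iff_of_eq (congrFun h.eq_left X)]
  exact ⟨fun hX => hX.1, fun hX => ⟨hX, hX.1⟩⟩

theorem mem_iff_right (X : ModuleCat.{u} Λ) : 𝒞 X ↔ rightOrthogonal d 𝒞 X := by
  rw [iff_of_eq (congrFun h.eq_right X)]
  exact ⟨fun hX => hX.1, fun hX => ⟨hX, hX.1⟩⟩

theorem subsingleton_ext {X C : ModuleCat.{u} Λ} (hX : 𝒞 X) (hC : 𝒞 C) {i : ℕ} (h1 : 1 ≤ i)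
    (hi : i ≤ d) : Subsingleton (Abelian.Ext.{u} X C i) :=
  ((h.mem_iff_left X).1 hX).2 C hC i h1 hi

theorem mem_of_injective {X : ModuleCat.{u} Λ} [Injective X] (hX : finMod Λ X) : 𝒞 X :=
  (h.mem_iff_right X).2 ⟨hX, fun C _ i h1 _ =>
    HasInjectiveDimensionLT.subsingleton X 1 i h1 C⟩

theorem mem_of_retract {X Y : ModuleCat.{u} Λ} (r : Retract X Y) (hY : 𝒞 Y) : 𝒞 X :=
  (h.mem_iff_left X).2 ⟨finMod_of_retract r (h.le _ hY), fun C hC i h1 hi =>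
    subsingleton_ext_of_retract_left r C i (h.subsingleton_ext hY hC h1 hi)⟩

/-- Embedding `Y` in an injective of `𝒞` trades `Extʲ(Y, C)` for `Extʲ⁺¹` of a cokernel whose
injective dimension bound is one lower, so `j + m` stays constant. -/
theorem subsingleton_ext_of_hasInjectiveDimensionLT (hΛ : FinModHasEnoughInjectives Λ)
    {C : ModuleCat.{u} Λ} (hC : 𝒞 C) (m : ℕ) {Y : ModuleCat.{u} Λ} (hY : finMod Λ Y)
    (hm : HasInjectiveDimensionLT Y (m + 1)) {j : ℕ} (h1 : 1 ≤ j) (hj : j + m ≤ d) :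
    Subsingleton (Abelian.Ext.{u} Y C j) := by
  induction m generalizing Y j with
  | zero =>
    have : Injective Y := injective_iff_hasInjectiveDimensionLT_one.2 hm
    exact h.subsingleton_ext (h.mem_of_injective hY) hC h1 hj
  | succ m ih =>
    obtain ⟨I, f, hI, hIinj, hf⟩ := hΛ.exists_mono Y hY
    have hse := shortExact_cokernel f
    have hm' := (hse.hasInjectiveDimensionLT_X₃_iff m hIinj).2 hm
    exact subsingleton_ext_X₁ hse C j
      (h.subsingleton_ext (h.mem_of_injective hI) hC h1 (by omega))
      (ih (finMod_of_epi (Limits.cokernel.π f) hI) hm' (by omega) (by omega))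

/-- A module of injective dimension at most `d` has the property that its maps to `𝒞` extend to
finitely generated injective modules containing it. -/
theorem exists_factor (hΛ : FinModHasEnoughInjectives Λ) (hd : 1 ≤ d) {C X I : ModuleCat.{u} Λ}
    (hC : 𝒞 C) (hX : HasInjectiveDimensionLT X (d + 1)) (hI : finMod Λ I) [Injective I]
    (i : X ⟶ I) [Mono i] (g : X ⟶ C) : ∃ k : I ⟶ C, i ≫ k = g := by
  have hse := shortExact_cokernel i
  obtain ⟨e, rfl⟩ := Nat.exists_eq_add_of_le' hd
  have h3 := (hse.hasInjectiveDimensionLT_X₃_iff e inferInstance).2 hX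
  exact exists_factor_of_subsingleton_ext_one hse
    (h.subsingleton_ext_of_hasInjectiveDimensionLT hΛ hC e
      (finMod_of_epi (Limits.cokernel.π i) hI) h3 le_rfl (by omega)) g

/-- If `gl.dim Λ ≤ d + 1`, the only indecomposables in `𝒞` receiving nonzero maps from injective
modules are the injective ones. -/
theorem injective_of_hom_ne_zero (hΛ : FinModHasEnoughInjectives Λ) (hd : 1 ≤ d)
    (hgl : ∀ X : ModuleCat.{u} Λ, HasInjectiveDimensionLT X (d + 2))
    {C I : ModuleCat.{u} Λ} (hC : 𝒞 C) (hind : Indecomposable C) (hI : finMod Λ I) [Injective I]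
    (f : I ⟶ C) (hf : f ≠ 0) : Injective C := by
  let p := Limits.factorThruImage f
  have hse : (ShortComplex.mk (Limits.kernel.ι p) p (Limits.kernel.condition p)).ShortExact :=
    { exact := ShortComplex.exact_kernel p }
  -- The image is a quotient of an injective, which improves the global bound by one.
  have hX : HasInjectiveDimensionLT (Limits.image f) (d + 1) :=
    hse.hasInjectiveDimensionLT_X₃ (d + 1)
      (hasInjectiveDimensionLT_of_ge I 1 (d + 1) (by omega)) (hgl _)
  obtain ⟨J, i, hJ, hJinj, hi⟩ := hΛ.exists_mono (Limits.image f) (finMod_of_epi p hI)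
  obtain ⟨k, hk⟩ := h.exists_factor hΛ hd hC hX hJ i (Limits.image.ι f)
  refine injective_of_factors (hΛ.isFiniteLength C (h.le _ hC)) hind (Limits.image.ι f) ?_ i k hk
  intro h0
  apply hf
  rw [← Limits.image.fac f, h0, Limits.comp_zero]

theorem exists_factor_of_forall_indecomposable (hΛ : FinModHasEnoughInjectives Λ)
    {X J : ModuleCat.{u} Λ} (i : X ⟶ J)
    (hind : ∀ C, 𝒞 C → Indecomposable C → ∀ g : X ⟶ C, ∃ k : J ⟶ C, i ≫ k = g)
    {C : ModuleCat.{u} Λ} (hC : 𝒞 C) (g : X ⟶ C) : ∃ k : J ⟶ C, i ≫ k = g := by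
  refine indecomposable_induction (Q := fun C => 𝒞 C → ∀ g : X ⟶ C, ∃ k : J ⟶ C, i ≫ k = g)
    ?_ ?_ ?_ C (hΛ.isFiniteLength C (h.le _ hC)) hC g
  · intro Y hY _ g
    exact ⟨0, hY.eq_of_tgt _ _⟩
  · intro Y hY hYC g
    exact hind Y hYC hY g
  · intro Y Z W e hY hZ hW g
    let rY : Retract Y W := ⟨Limits.biprod.inl ≫ e.inv, e.hom ≫ Limits.biprod.fst, by simp⟩
    let rZ : Retract Z W := ⟨Limits.biprod.inr ≫ e.inv, e.hom ≫ Limits.biprod.snd, by simp⟩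
    obtain ⟨k, hk⟩ := hY (h.mem_of_retract rY hW) (g ≫ e.hom ≫ Limits.biprod.fst)
    obtain ⟨l, hl⟩ := hZ (h.mem_of_retract rZ hW) (g ≫ e.hom ≫ Limits.biprod.snd)
    refine ⟨Limits.biprod.lift k l ≫ e.inv, ?_⟩
    rw [← Category.assoc, Iso.comp_inv_eq]
    exact Limits.biprod.hom_ext _ _ (by simp [hk]) (by simp [hl])

/-- It suffices to treat indecomposable targets. A nonzero map from `Y` stays nonzero on `I`, so its
target is injective and the extension is automatic. -/
theorem exists_factor_of_epi (hΛ : FinModHasEnoughInjectives Λ) (hd : 1 ≤ d)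
    (hgl : ∀ X : ModuleCat.{u} Λ, HasInjectiveDimensionLT X (d + 2))
    {I Y J : ModuleCat.{u} Λ} (hI : finMod Λ I) [Injective I] (p : I ⟶ Y) [Epi p]
    (i : Y ⟶ J) [Mono i] {C : ModuleCat.{u} Λ} (hC : 𝒞 C) (g : Y ⟶ C) :
    ∃ k : J ⟶ C, i ≫ k = g := by
  refine h.exists_factor_of_forall_indecomposable hΛ i (fun C hC hind g => ?_) hC g
  by_cases hpg : p ≫ g = 0
  · refine ⟨0, ?_⟩
    rw [Limits.comp_zero, ← cancel_epi p, hpg, Limits.comp_zero]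
  · have := h.injective_of_hom_ne_zero hΛ hd hgl hC hind hI (p ≫ g) hpg
    exact ⟨Injective.factorThru g i, Injective.comp_factorThru g i⟩

/-- A quotient of an injective module that is partially orthogonal to `𝒞` has small injective
dimension. -/
theorem hasInjectiveDimensionLT_of_epi (hΛ : FinModHasEnoughInjectives Λ) (hd : 1 ≤ d)
    (hgl : ∀ X : ModuleCat.{u} Λ, HasInjectiveDimensionLT X (d + 2)) (m : ℕ)
    {I Y : ModuleCat.{u} Λ} (hI : finMod Λ I) [Injective I] (p : I ⟶ Y) [Epi p]
    (hY : ∀ C, 𝒞 C → ∀ j, 1 ≤ j → j + m ≤ d → Subsingleton (Abelian.Ext.{u} Y C j)) :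
    HasInjectiveDimensionLT Y (m + 1) := by
  have hYfin : finMod Λ Y := finMod_of_epi p hI
  obtain ⟨J, i, hJ, hJinj, hi⟩ := hΛ.exists_mono Y hYfin
  induction m generalizing I Y J with
  | zero =>
    have hYC : 𝒞 Y := (h.mem_iff_left Y).2 ⟨hYfin, fun C hC j h1 hj => hY C hC j h1 hj⟩
    -- For `m = 0` the hypotheses put `Y` itself in `𝒞`; extending its identity splits `i`.
    obtain ⟨k, hk⟩ := h.exists_factor_of_epi hΛ hd hgl hI p i hYC (𝟙 Y)
    let r : Retract Y J := ⟨i, k, hk⟩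
    have := r.injective
    infer_instance
  | succ m ih =>
    have hse := shortExact_cokernel i
    have hfin : finMod Λ (Limits.cokernel i) := finMod_of_epi (Limits.cokernel.π i) hJ
    obtain ⟨J', i', hJ', hJinj', hi'⟩ := hΛ.exists_mono _ hfin
    refine (hse.hasInjectiveDimensionLT_X₃_iff m hJinj).1
      (ih hJ (Limits.cokernel.π i) ?_ hfin J' i' hJ' hJinj' hi')
    intro C hC j h1 hj
    have hJC := h.mem_of_injective hJ
    obtain ⟨j, rfl⟩ := Nat.exists_eq_add_of_le' h1
    rcases Nat.eq_zero_or_pos j with rfl | hj0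
    -- Degree one cannot be shifted down to an Ext group of `Y`; it comes from the extension
    -- property instead.
    · exact subsingleton_ext_one_X₃ hse (h.exists_factor_of_epi hΛ hd hgl hI p i hC)
        (h.subsingleton_ext hJC hC le_rfl hd)
    · exact subsingleton_ext_X₃ hse C j (hY C hC j hj0 (by omega))
        (h.subsingleton_ext hJC hC h1 (by omega))

/-- A simple module has injective dimension at most `d` if and only if it has no nonzero maps to
indecomposables of `𝒞` other than its injective envelope. -/
theorem hasInjectiveDimensionLT_iff_of_simple (hΛ : FinModHasEnoughInjectives Λ) (hd : 1 ≤ d)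
    (hgl : ∀ X : ModuleCat.{u} Λ, HasInjectiveDimensionLT X (d + 2))
    (S : ModuleCat.{u} Λ) [Simple S] :
    HasInjectiveDimensionLT S (d + 1) ↔ ∀ C : ModuleCat.{u} Λ, 𝒞 C → Indecomposable C →
      ¬ IsInjectiveEnvelopeOf S C → Subsingleton (S ⟶ C) := by
  have hSfin : finMod Λ S := by
    have := isSimpleModule_of_simple S
    exact inferInstanceAs (Module.Finite Λ S)
  obtain ⟨I, i, hI, hIinj, hi⟩ := hΛ.exists_mono S hSfin
  constructor
  · intro hS C hC hind hSC
    refine subsingleton_of_forall_eq 0 fun g => ?_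
    by_contra hg
    have := mono_of_nonzero_from_simple hg
    obtain ⟨k, hk⟩ := h.exists_factor hΛ hd hC hS hI i g
    have hCfl := hΛ.isFiniteLength C (h.le _ hC)
    have := injective_of_factors hCfl hind g hg i k hk
    exact hSC ⟨g, isInjectiveEnvelope_of_indecomposable hCfl hind g hg⟩
  · intro hhom
    have hse := shortExact_cokernel i
    obtain ⟨e, rfl⟩ := Nat.exists_eq_add_of_le' hd
    refine (hse.hasInjectiveDimensionLT_X₃_iff e hIinj).1
      (h.hasInjectiveDimensionLT_of_epi hΛ hd hgl e hI (Limits.cokernel.π i) ?_)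
    intro C hC j h1 hj
    -- Here `d = e + 1`, so `j + e ≤ d` leaves only degree one.
    obtain rfl : j = 1 := by omega
    refine subsingleton_ext_one_X₃ hse (fun g => ?_)
      (h.subsingleton_ext (h.mem_of_injective hI) hC le_rfl hd)
    refine h.exists_factor_of_forall_indecomposable hΛ i (fun C hC hind g => ?_) hC g
    by_cases hSC : IsInjectiveEnvelopeOf S C
    · obtain ⟨f, hf⟩ := hSC
      have := hf.injective
      exact ⟨Injective.factorThru g i, Injective.comp_factorThru g i⟩
    · have := hhom C hC hind hSC
      exact ⟨0, Subsingleton.elim _ _⟩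

theorem injective_iff_of_simple (hΛ : FinModHasEnoughInjectives Λ) (hd : 1 ≤ d)
    (hgl : ∀ X : ModuleCat.{u} Λ, HasInjectiveDimensionLT X (d + 2))
    (S : ModuleCat.{u} Λ) [Simple S] :
    Injective S ↔ 𝒞 S ∧ ∀ C : ModuleCat.{u} Λ, 𝒞 C → Indecomposable C →
      ¬ IsInjectiveEnvelopeOf S C → Subsingleton (S ⟶ C) := by
  rw [← h.hasInjectiveDimensionLT_iff_of_simple hΛ hd hgl S]
  constructor
  · intro hS
    refine ⟨h.mem_of_injective ?_, hasInjectiveDimensionLT_of_ge S 1 (d + 1) (by omega)⟩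
    have := isSimpleModule_of_simple S
    exact inferInstanceAs (Module.Finite Λ S)
  · rintro ⟨hSC, hS⟩
    rw [h.hasInjectiveDimensionLT_iff_of_simple hΛ hd hgl S] at hS
    by_contra hinj
    -- Test on `C = S`: a non-injective `S` is not its own envelope, so its identity would vanish.
    have := hS S hSC (indecomposable_of_simple S) fun ⟨f, hf⟩ => hinj hf.injective
    exact Simple.not_isZero S ((Limits.IsZero.iff_id_eq_zero S).2 (Subsingleton.elim _ _))

end IsMaximalOrthogonal

/-! ### Global dimension and maps to projectives -/

section Projective

variable {Λ : Type u} [Ring Λ]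

theorem hasProjectiveDimensionLT_of_globalDimension_le {n : ℕ}
    (hgl : globalDimension Λ ≤ (n : WithBot ℕ∞)) (X : ModuleCat.{u} Λ) :
    HasProjectiveDimensionLT X (n + 1) :=
  (projectiveDimension_le_iff X n).1
    ((le_iSup (fun X : ModuleCat.{u} Λ => projectiveDimension X) X).trans hgl)

theorem hasInjectiveDimensionLT_of_globalDimension_le {n : ℕ}
    (hgl : globalDimension Λ ≤ (n : WithBot ℕ∞)) (X : ModuleCat.{u} Λ) :
    HasInjectiveDimensionLT X (n + 1) := by
  rw [hasInjectiveDimensionLT_iff.{u}]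
  intro i hi Y e
  have := hasProjectiveDimensionLT_of_globalDimension_le hgl Y
  exact e.eq_zero_of_hasProjectiveDimensionLT (n + 1) hi

/-- If `gl.dim Λ ≤ n`, then a simple module of projective dimension `n ≥ 1` has no nonzero maps to
projective modules. -/
theorem subsingleton_hom_projective {n : ℕ} (hn : 1 ≤ n)
    (hgl : globalDimension Λ ≤ (n : WithBot ℕ∞)) {Q : ModuleCat.{u} Λ} [Projective Q]
    (S : ModuleCat.{u} Λ) [Simple S]
    (hpd : projectiveDimension S = (n : WithBot ℕ∞)) : Subsingleton (S ⟶ Q) := by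
  refine subsingleton_of_forall_eq 0 fun g => ?_
  by_contra hg
  have := mono_of_nonzero_from_simple hg
  -- An embedding into `Q` makes `S` a syzygy of a module of projective dimension at most `n`, so
  -- `pd S < n`.
  have hS := (shortExact_cokernel g).hasProjectiveDimensionLT_X₁ n
    (hasProjectiveDimensionLT_of_ge Q 1 n hn)
    (hasProjectiveDimensionLT_of_globalDimension_le hgl _)
  have := projectiveDimension_lt_iff.2 hS
  rw [show (ShortComplex.mk g (Limits.cokernel.π g) (Limits.cokernel.condition g)).X₁ = S from rfl,
    hpd] at this
  exact lt_irrefl _ this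

end Projective

end HigherAuslander

/-! ### Assembly of the three equivalences -/

theorem proposition3p9 {R : Type*} [CommRing R] [IsArtinianRing R]
    {Λ : Type u} [Ring Λ] [Algebra R Λ] [Module.Finite R Λ]
    (n : ℕ) (hn : 2 ≤ n)
    (hΛ : HigherAuslander.IsAuslanderAlgebra Λ (n - 1))
    (hgl : HigherAuslander.globalDimension Λ = (n : WithBot ℕ∞))
    (𝒞 : ObjectProperty (ModuleCat.{u} Λ))
    (h𝒞 : HigherAuslander.IsMaximalOrthogonal (n - 1) 𝒞 (HigherAuslander.finMod Λ))
    (S : ModuleCat.{u} Λ) (hS : Simple S)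
    (hpd : projectiveDimension S = (n : WithBot ℕ∞)) :
    -- each part is stated with `C` ranging over all indecomposables of `𝒞`, and again with `C`
    -- ranging over the non-projective ones only
    ((Injective S ↔
        𝒞 S ∧ ∀ C : ModuleCat.{u} Λ, 𝒞 C → Indecomposable C →
          ¬ HigherAuslander.IsInjectiveEnvelopeOf S C → Subsingleton (S ⟶ C)) ∧
      (Injective S ↔
        𝒞 S ∧ ∀ C : ModuleCat.{u} Λ, 𝒞 C → Indecomposable C → ¬ Projective C →
          ¬ HigherAuslander.IsInjectiveEnvelopeOf S C → Subsingleton (S ⟶ C))) ∧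
    ((1 ≤ injectiveDimension S ∧ injectiveDimension S ≤ ((n - 1 : ℕ) : WithBot ℕ∞) ↔
        ¬ 𝒞 S ∧ ∀ C : ModuleCat.{u} Λ, 𝒞 C → Indecomposable C →
          ¬ HigherAuslander.IsInjectiveEnvelopeOf S C → Subsingleton (S ⟶ C)) ∧
      (1 ≤ injectiveDimension S ∧ injectiveDimension S ≤ ((n - 1 : ℕ) : WithBot ℕ∞) ↔
        ¬ 𝒞 S ∧ ∀ C : ModuleCat.{u} Λ, 𝒞 C → Indecomposable C → ¬ Projective C →
          ¬ HigherAuslander.IsInjectiveEnvelopeOf S C → Subsingleton (S ⟶ C))) ∧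
    ((injectiveDimension S = (n : WithBot ℕ∞) ↔
        ∃ C : ModuleCat.{u} Λ, 𝒞 C ∧ Indecomposable C ∧
          ¬ HigherAuslander.IsInjectiveEnvelopeOf S C ∧ Nontrivial (S ⟶ C)) ∧
      (injectiveDimension S = (n : WithBot ℕ∞) ↔
        ∃ C : ModuleCat.{u} Λ, 𝒞 C ∧ Indecomposable C ∧ ¬ Projective C ∧
          ¬ HigherAuslander.IsInjectiveEnvelopeOf S C ∧ Nontrivial (S ⟶ C))) := by
  obtain ⟨d, rfl⟩ := Nat.exists_eq_add_of_le' (show 1 ≤ n by omega)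
  rw [Nat.add_sub_cancel] at h𝒞 ⊢
  have hd : 1 ≤ d := by omega
  have hmod := HigherAuslander.finModHasEnoughInjectives R Λ
  have hid : ∀ X : ModuleCat.{u} Λ, HasInjectiveDimensionLT X (d + 2) :=
    HigherAuslander.hasInjectiveDimensionLT_of_globalDimension_le hgl.le
  have hinj := h𝒞.injective_iff_of_simple hmod hd hid S
  have hlt := h𝒞.hasInjectiveDimensionLT_iff_of_simple hmod hd hid S
  have hnp : (∀ C : ModuleCat.{u} Λ, 𝒞 C → Indecomposable C →
        ¬ HigherAuslander.IsInjectiveEnvelopeOf S C → Subsingleton (S ⟶ C)) ↔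
      ∀ C : ModuleCat.{u} Λ, 𝒞 C → Indecomposable C → ¬ Projective C →
        ¬ HigherAuslander.IsInjectiveEnvelopeOf S C → Subsingleton (S ⟶ C) := by
    refine ⟨fun h C hC hind _ => h C hC hind, fun h C hC hind hSC => ?_⟩
    by_cases hp : Projective C
    · exact HigherAuslander.subsingleton_hom_projective (by omega) hgl.le S hpd
    · exact h C hC hind hp hSC
  have hone : 1 ≤ injectiveDimension S ↔ ¬ Injective S := by
    rw [injective_iff_hasInjectiveDimensionLT_one]
    exact injectiveDimension_ge_iff S 1
  have hle : injectiveDimension S ≤ (d : WithBot ℕ∞) ↔ HasInjectiveDimensionLT S (d + 1) :=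
    injectiveDimension_le_iff S d
  -- The global bound `id S ≤ d + 1` turns equality into failure of `id S ≤ d`, so (3) is the
  -- negation of the main equivalence.
  have heq : injectiveDimension S = ((d + 1 : ℕ) : WithBot ℕ∞) ↔
      ¬ HasInjectiveDimensionLT S (d + 1) := by
    rw [← injectiveDimension_ge_iff]
    exact ⟨fun h => h.ge, fun h => le_antisymm ((injectiveDimension_le_iff S (d + 1)).2 (hid S)) h⟩
  refine ⟨⟨hinj, by rw [← hnp]; exact hinj⟩, ⟨?_, ?_⟩, ?_, ?_⟩
  · rw [hone, hle, hinj, hlt]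
    tauto
  · rw [← hnp, hone, hle, hinj, hlt]
    tauto
  · rw [heq, hlt]
    push Not
    rfl
  · rw [heq, hlt, hnp]
    push Not
    rfl
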